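/- Let $d$ and $n$ be natural numbers with $2\le n\le d-1$. Let $\mathcal U(d)$ be the group of unitary $d\times d$ complex matrices and $SU(d)$ its subgroup of matrices of determinant $1$. A unitary representation of a group $G$ is a group homomorphism from $G$ to the group of unitary operators on a complex inner product space $V$; it is irreducible if $V\neq 0$ and the only $G$-invariant linear subspaces of $V$ are $0$ and $V$. Then neither $\mathcal U(d)$ nor $SU(d)$ has an irreducible unitary representation on a space $V$ of complex dimension $n$. (Continuity of the representation is not required; in particular there is no continuous one.) -/

import Mathlib

/-- A representation of a group `G` on a complex inner product space `V` is unitary if every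
group element acts by an operator that preserves the inner product. (As every `ρ g` is invertible
with inverse `ρ g⁻¹`, this says that every `ρ g` is a unitary operator.) No continuity in `g` is
required. -/
def Representation.IsUnitary {G V : Type*} [Group G] [NormedAddCommGroup V]
    [InnerProductSpace ℂ V] (ρ : Representation ℂ G V) : Prop :=
  ∀ (g : G) (v w : V), inner ℂ (ρ g v) (ρ g w) = inner ℂ v w

open Matrix Module

/-! Let `ρ` be a unitary representation of `SU(d)` in dimension below `d`. The diagonal torus acts
by commuting isometries, so the space is the sum of its joint eigenspaces. Permutation matrices,
rescaled into `SU(d)`, permute the coordinates of a weight; a weight not constant over the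
coordinates would have `d` distinct translates, hence `d` independent nonzero eigenspaces
(`weight_eq_of_finrank_lt`). A constant weight is trivial (`map_specialTorus_of_finrank_lt`), so the
torus acts trivially. By diagonalisation every unitary matrix is a scalar times a kernel element, so
all operators commute and an irreducible `ρ` has dimension one. -/

/-- A nonconstant family indexed by `ι` has at least `card ι` distinct rearrangements. -/
lemma exists_perm_family_comp_injective {ι α : Type*} [DecidableEq ι] (χ : ι → α) {a b : ι}
    (h : χ a ≠ χ b) :
    ∃ F : ι → Equiv.Perm ι, Function.Injective fun k => χ ∘ F k := by
  classical
  -- For `k ≠ a`, the rearrangement differs from `χ` exactly on `{k, b}` or on `{a, k}`; these pairs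
  -- are distinct.
  refine ⟨fun k => if k = a then 1 else if χ k = χ a then Equiv.swap k b else Equiv.swap a k, ?_⟩
  intro k l hkl
  have e : ∀ m, _ := fun m => congrFun hkl m
  have ea := e a
  have eb := e b
  have ek := e k
  have el := e l
  simp only [Function.comp_apply] at ea eb ek el
  by_contra hne
  split_ifs at ea eb ek el <;>
    simp only [Equiv.swap_apply_def, Equiv.Perm.one_apply] at ea eb ek el <;> grind

/-- A generalised eigenvector of an isometry is an eigenvector. -/
lemma Module.End.maxGenEigenspace_le_eigenspace_of_inner_map_map {V : Type*}
    [NormedAddCommGroup V] [InnerProductSpace ℂ V] (T : End ℂ V)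
    (hT : ∀ v w, inner ℂ (T v) (T w) = inner ℂ v w) (μ : ℂ) :
    T.maxGenEigenspace μ ≤ T.eigenspace μ := by
  -- No Jordan block of size two: `⟨Tw, Tw⟩ = ⟨w, w⟩` gives `|μ| = 1`, and then `⟨Tw, Tv⟩ = ⟨w, v⟩`
  -- forces `⟨w, w⟩ = 0`.
  have key : ∀ v : V, (T - μ • (1 : End ℂ V)) ((T - μ • (1 : End ℂ V)) v) = 0 →
      (T - μ • (1 : End ℂ V)) v = 0 := by
    intro v hv
    set w := (T - μ • (1 : End ℂ V)) v with hw
    have h1 : T v = μ • v + w := by simp [hw]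
    have h2 : T w = μ • w := by simpa [sub_eq_zero] using hv
    have h3 := hT w w
    have h4 := hT w v
    rw [h2, inner_smul_left, inner_smul_right] at h3
    rw [h1, h2, inner_add_right, inner_smul_left, inner_smul_left, inner_smul_right] at h4
    by_contra hne
    have hww : inner ℂ w w ≠ 0 := inner_self_ne_zero.2 hne
    have hμ : (starRingEnd ℂ) μ * μ = 1 := by
      apply mul_right_cancel₀ hww
      linear_combination h3
    have hμ0 : (starRingEnd ℂ) μ ≠ 0 := left_ne_zero_of_mul_eq_one hμ
    have : (starRingEnd ℂ) μ * inner ℂ w w = 0 := by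
      linear_combination h4 - inner ℂ w v * hμ
    exact (mul_ne_zero hμ0 hww) this
  intro v hv
  obtain ⟨k, hk⟩ := (End.mem_maxGenEigenspace T μ v).1 hv
  rw [End.mem_eigenspace_iff]
  suffices (T - μ • (1 : End ℂ V)) v = 0 by simpa [sub_eq_zero] using this
  induction k with
  | zero => simp_all
  | succ k ih =>
    rcases k with _ | k
    · simpa using hk
    · apply ih
      rw [pow_succ', End.mul_apply]
      apply key
      rwa [pow_succ', pow_succ', End.mul_apply, End.mul_apply] at hk

/-! ### Diagonalising unitary matrices by the Cayley transform -/

instance Circle.instInfinite : Infinite Circle := by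
  have : Infinite (Set.Ioo (0 : ℝ) 1) := (Set.Ioo_infinite one_pos).to_subtype
  refine Infinite.of_injective (fun x : Set.Ioo (0 : ℝ) 1 => Circle.exp x) fun x y hxy => ?_
  have hx := Circle.arg_exp (x := x) (by linarith [x.2.1, Real.pi_pos])
    (by linarith [x.2.2, Real.pi_gt_three])
  have hy := Circle.arg_exp (x := y) (by linarith [y.2.1, Real.pi_pos])
    (by linarith [y.2.2, Real.pi_gt_three])
  exact Subtype.ext (by rw [← hx, ← hy]; exact congrArg (fun c : Circle => (c : ℂ).arg) hxy)

lemma Matrix.exists_circle_det_one_add_smul_ne_zero {d : ℕ} (U : Matrix (Fin d) (Fin d) ℂ) :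
    ∃ c : Circle, (1 + (c : ℂ) • U).det ≠ 0 := by
  by_contra! h
  have hfin : (spectrum ℂ U).Finite := Matrix.finite_spectrum U
  have : Set.range (fun c : Circle => (c : ℂ)) ⊆ spectrum ℂ U := by
    rintro _ ⟨c, rfl⟩
    have h1 := h (-c)⁻¹
    rw [spectrum.mem_iff, Matrix.isUnit_iff_isUnit_det, isUnit_iff_ne_zero, not_not]
    have h2 : algebraMap ℂ (Matrix (Fin d) (Fin d) ℂ) c - U
        = (c : ℂ) • (1 + (((-c)⁻¹ : Circle) : ℂ) • U) := by
      have : (c : ℂ) ≠ 0 := c.coe_ne_zero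
      rw [smul_add, smul_smul, Algebra.algebraMap_eq_smul_one]
      simp [this, sub_eq_add_neg]
    rw [h2, Matrix.det_smul, h1, mul_zero]
  have h2 : (Set.range (fun c : Circle => (c : ℂ))).Finite := hfin.subset this
  have h3 : Finite Circle :=
    (Set.finite_range_iff (f := fun c : Circle => (c : ℂ)) Circle.coe_injective).1 h2
  exact not_finite Circle

/-- Unitary matrices are unitarily diagonalisable. -/
lemma Matrix.exists_unitary_diagonalization {d : ℕ} {U : Matrix (Fin d) (Fin d) ℂ}
    (hU : U ∈ unitaryGroup (Fin d) ℂ) :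
    ∃ W ∈ unitaryGroup (Fin d) ℂ, ∃ z : Fin d → Circle,
      U = W * diagonal (fun i => (z i : ℂ)) * star W := by
  suffices ∃ W ∈ unitaryGroup (Fin d) ℂ, ∃ z : Fin d → ℂ, U = W * diagonal z * star W by
    obtain ⟨W, hW, z, rfl⟩ := this
    have hD : diagonal z ∈ unitaryGroup (Fin d) ℂ := by
      have : diagonal z = star W * (W * diagonal z * star W) * W := by
        simp only [mul_assoc, hW.1, mul_one]
        rw [← mul_assoc, hW.1, one_mul]
      rw [this]
      exact mul_mem (mul_mem (Unitary.star_mem hW) hU) hW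
    have hz : ∀ i, z i ∈ Submonoid.unitSphere ℂ := by
      intro i
      have h1 := congrFun (congrFun (mem_unitaryGroup_iff.1 hD) i) i
      rw [star_eq_conjTranspose, diagonal_conjTranspose, diagonal_mul_diagonal] at h1
      rw [diagonal_apply_eq, one_apply_eq] at h1
      have h2 : ‖z i‖ ^ 2 = 1 := by
        exact_mod_cast (Complex.mul_conj' (z i)).symm.trans h1
      simpa [Submonoid.unitSphere] using (pow_eq_one_iff_of_nonneg (norm_nonneg (z i)) two_ne_zero).1 h2
    exact ⟨W, hW, fun i => ⟨z i, hz i⟩, rfl⟩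
  obtain ⟨c, hc⟩ := Matrix.exists_circle_det_one_add_smul_ne_zero U
  set U' := (c : ℂ) • U with hU'
  have hU'1 : U'ᴴ * U' = 1 := by
    rw [hU', conjTranspose_smul, smul_mul_smul_comm, ← star_eq_conjTranspose, hU.1]
    simp [← Circle.coe_inv_eq_conj]
  set X := 1 + U' with hX
  have hXu : IsUnit X.det := isUnit_iff_ne_zero.2 hc
  -- This is the Cayley transform `i(1 - U')(1 + U')⁻¹`, in a form that is visibly Hermitian.
  set A := (X⁻¹)ᴴ * (Complex.I • (U'ᴴ - U')) * X⁻¹ with hA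
  have hAh : A.IsHermitian := by
    apply isHermitian_conjTranspose_mul_mul
    simp [IsHermitian, conjTranspose_smul, ← smul_neg]
  have hAX : A * X = Complex.I • (1 - U') := by
    rw [hA, mul_assoc, nonsing_inv_mul _ hXu, mul_one]
    have h1 : Xᴴ * (1 - U') = U'ᴴ - U' := by
      simp only [hX, conjTranspose_add, conjTranspose_one, add_mul, mul_sub, hU'1]
      simp only [mul_one, one_mul]
      abel
    rw [← h1, ← mul_smul_comm, ← mul_assoc, ← conjTranspose_mul, mul_nonsing_inv _ hXu]
    simp
  have hAU : (A + Complex.I • 1) * U' = Complex.I • 1 - A := by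
    rw [hX, mul_add, mul_one] at hAX
    have : A * U' = Complex.I • (1 - U') - A := eq_sub_of_add_eq' hAX
    rw [add_mul, this, smul_sub, smul_mul_assoc, one_mul]
    abel
  obtain ⟨W, hW⟩ : ∃ W : unitaryGroup (Fin d) ℂ, W = hAh.eigenvectorUnitary := ⟨_, rfl⟩
  have hs := hAh.spectral_theorem
  rw [← hW, Unitary.conjStarAlgAut_apply] at hs
  have hW1 : star (W : Matrix (Fin d) (Fin d) ℂ) * W = 1 := W.2.1
  have hW2 : (W : Matrix (Fin d) (Fin d) ℂ) * star (W : Matrix (Fin d) (Fin d) ℂ) = 1 := W.2.2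
  set a : Fin d → ℂ := RCLike.ofReal ∘ hAh.eigenvalues with ha
  set D := star (W : Matrix (Fin d) (Fin d) ℂ) * U' * W with hD
  have hU'D : U' = W * D * star (W : Matrix (Fin d) (Fin d) ℂ) := by
    rw [hD]
    calc U' = (W * star (W : Matrix (Fin d) (Fin d) ℂ)) * U' *
          (W * star (W : Matrix (Fin d) (Fin d) ℂ)) := by rw [hW2]; simp
      _ = _ := by simp only [mul_assoc]
  have hAD : star (W : Matrix (Fin d) (Fin d) ℂ) * A * W = diagonal a := by
    rw [hs]
    calc _ = (star (W : Matrix (Fin d) (Fin d) ℂ) * W) * diagonal a *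
          (star (W : Matrix (Fin d) (Fin d) ℂ) * W) := by simp only [mul_assoc]
      _ = _ := by rw [hW1]; simp
  have hrel : (diagonal a + Complex.I • 1) * D = Complex.I • 1 - diagonal a := by
    have h1 : star (W : Matrix (Fin d) (Fin d) ℂ) * ((A + Complex.I • 1) * U') * W =
        star (W : Matrix (Fin d) (Fin d) ℂ) * (Complex.I • 1 - A) * W := by rw [hAU]
    have h2 : star (W : Matrix (Fin d) (Fin d) ℂ) * (Complex.I • 1 - A) * W =
        Complex.I • 1 - diagonal a := by
      rw [mul_sub, sub_mul, hAD]; simp [hW1]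
    have h3 : diagonal a + Complex.I • 1 =
        star (W : Matrix (Fin d) (Fin d) ℂ) * (A + Complex.I • 1) * W := by
      rw [mul_add, add_mul, hAD]; simp [hW1]
    rw [← h2, ← h1, h3, hD]
    calc _ = star (W : Matrix (Fin d) (Fin d) ℂ) * (A + Complex.I • 1) *
          (W * star (W : Matrix (Fin d) (Fin d) ℂ)) * U' * W := by simp only [mul_assoc]
      _ = _ := by rw [hW2]; simp only [mul_assoc, one_mul]
  -- The eigenvalues `a i` are real, so `hrel` can be solved for `D`, which is therefore diagonal.
  have hane : ∀ i, a i + Complex.I ≠ 0 := by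
    intro i h0
    have := congrArg Complex.im h0
    simp [ha] at this
  have hDd : D = diagonal fun i => (Complex.I - a i) / (a i + Complex.I) := by
    ext i j
    have h1 := congrFun (congrFun hrel i) j
    rw [← diagonal_one, ← diagonal_smul, diagonal_add, diagonal_sub, diagonal_mul] at h1
    by_cases hij : i = j
    · subst hij
      simp at h1 ⊢
      rw [eq_div_iff (hane i), mul_comm]
      exact h1
    · simp [hij] at h1 ⊢
      exact h1.resolve_left (hane i)
  refine ⟨W, W.2, fun i => (c : ℂ)⁻¹ * ((Complex.I - a i) / (a i + Complex.I)), ?_⟩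
  have hUc : U = (c : ℂ)⁻¹ • U' := by rw [hU', smul_smul]; simp
  have hdg : (diagonal fun i => (c : ℂ)⁻¹ * ((Complex.I - a i) / (a i + Complex.I)) :
      Matrix (Fin d) (Fin d) ℂ) = (c : ℂ)⁻¹ • D := by
    rw [hDd, ← diagonal_smul]; rfl
  rw [hdg, hUc, hU'D]
  simp

/-! ### Commuting isometries -/

section JointEigenspaces

variable {V ι : Type*} [NormedAddCommGroup V] [InnerProductSpace ℂ V] (f : ι → End ℂ V)

lemma Module.End.iInf_maxGenEigenspace_eq_of_inner_map_map
    (hf : ∀ i v w, inner ℂ (f i v) (f i w) = inner ℂ v w) (χ : ι → ℂ) :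
    ⨅ i, (f i).maxGenEigenspace (χ i) = ⨅ i, (f i).eigenspace (χ i) :=
  iInf_congr fun i => le_antisymm
    (maxGenEigenspace_le_eigenspace_of_inner_map_map _ (hf i) _)
    ((f i).genEigenspace_le_maximal _ 1)

lemma Module.End.iSup_iInf_eigenspace_eq_top_of_inner_map_map [FiniteDimensional ℂ V]
    (hf : ∀ i v w, inner ℂ (f i v) (f i w) = inner ℂ v w) (hc : ∀ i j, Commute (f i) (f j)) :
    ⨆ χ : ι → ℂ, ⨅ i, (f i).eigenspace (χ i) = ⊤ := by
  simp_rw [← iInf_maxGenEigenspace_eq_of_inner_map_map f hf]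
  exact iSup_iInf_maxGenEigenspace_eq_top_of_iSup_maxGenEigenspace_eq_top_of_commute f
    (fun i j _ => hc i j) fun i => iSup_maxGenEigenspace_eq_top (f i)

lemma Module.End.iSupIndep_iInf_eigenspace_of_inner_map_map
    (hf : ∀ i v w, inner ℂ (f i v) (f i w) = inner ℂ v w) (hc : ∀ i j, Commute (f i) (f j)) :
    iSupIndep fun χ : ι → ℂ => ⨅ i, (f i).eigenspace (χ i) := by
  simp_rw [← iInf_maxGenEigenspace_eq_of_inner_map_map f hf]
  exact independent_iInf_maxGenEigenspace_of_forall_mapsTo f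
    fun i j => mapsTo_maxGenEigenspace_of_comm (hc j i)

end JointEigenspaces

/-- An irreducible unitary representation with commuting operators is one-dimensional. -/
lemma Representation.IsUnitary.finrank_eq_one_of_commute {G V : Type*} [Group G]
    [NormedAddCommGroup V] [InnerProductSpace ℂ V] [FiniteDimensional ℂ V]
    {ρ : Representation ℂ G V} (hρ : ρ.IsUnitary) (hirr : ρ.IsIrreducible)
    (hc : ∀ g h, Commute (ρ g) (ρ h)) : finrank ℂ V = 1 := by
  have htop := End.iSup_iInf_eigenspace_eq_top_of_inner_map_map (fun g => ρ g) hρ hc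
  have hne : (⊤ : Submodule ℂ V) ≠ ⊥ := by
    intro h
    refine bot_ne_top (α := Subrepresentation ρ) ?_
    ext v
    exact iff_of_eq (congrArg (v ∈ ·) h.symm)
  obtain ⟨χ, hχ⟩ : ∃ χ : G → ℂ, ⨅ g, End.eigenspace (ρ g) (χ g) ≠ ⊥ := by
    by_contra! h
    exact hne (by rw [← htop]; simpa using h)
  obtain ⟨v, hv, hv0⟩ := Submodule.exists_mem_ne_zero_of_ne_bot hχ
  simp only [Submodule.mem_iInf, End.mem_eigenspace_iff] at hv
  let L : Subrepresentation ρ := ⟨ℂ ∙ v, fun g w hw => by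
    obtain ⟨c, rfl⟩ := Submodule.mem_span_singleton.1 hw
    rw [map_smul, hv g]
    exact Submodule.smul_mem _ _ (Submodule.smul_mem _ _ (Submodule.mem_span_singleton_self v))⟩
  have hL : (ℂ ∙ v) = ⊤ := by
    rcases eq_bot_or_eq_top L with h | h
    · have h1 : (ℂ ∙ v) = ⊥ := congrArg Subrepresentation.toSubmodule h
      exact absurd (Submodule.span_singleton_eq_bot.1 h1) hv0
    · exact congrArg Subrepresentation.toSubmodule h
  rw [← finrank_top ℂ V, ← hL, finrank_span_singleton hv0]

/-! ### The torus of `SU(d)` -/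

lemma Circle.exists_pow_eq (z : Circle) {d : ℕ} (hd : d ≠ 0) : ∃ w : Circle, w ^ d = z := by
  refine ⟨Circle.exp ((z : ℂ).arg / d), ?_⟩
  rw [← Circle.exp_natCast_mul]
  have : (d : ℝ) * ((z : ℂ).arg / d) = (z : ℂ).arg := by field_simp
  rw [this, Circle.exp_arg]

namespace Matrix

variable {d : ℕ}

lemma circle_smul_mem_unitaryGroup (c : Circle) {U : Matrix (Fin d) (Fin d) ℂ}
    (hU : U ∈ unitaryGroup (Fin d) ℂ) : (c : ℂ) • U ∈ unitaryGroup (Fin d) ℂ := by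
  rw [mem_unitaryGroup_iff, star_smul, smul_mul_smul_comm, hU.2]
  simp [← Circle.coe_inv_eq_conj]

/-- Every unitary matrix is a unimodular scalar times a special unitary matrix. -/
lemma exists_eq_smul_specialUnitary (hd : d ≠ 0) {U : Matrix (Fin d) (Fin d) ℂ}
    (hU : U ∈ unitaryGroup (Fin d) ℂ) :
    ∃ (c : Circle) (s : specialUnitaryGroup (Fin d) ℂ), U = (c : ℂ) • s.1 := by
  have hdet : ‖U.det‖ = 1 :=
    CStarRing.norm_of_mem_unitary (det_of_mem_unitary hU)
  obtain ⟨c, hc⟩ := Circle.exists_pow_eq ⟨U.det, mem_sphere_zero_iff_norm.2 hdet⟩ hd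
  have hc' : (c : ℂ) ^ d = U.det := by rw [← Circle.coe_pow, hc]
  refine ⟨c, ⟨((c⁻¹ : Circle) : ℂ) • U, circle_smul_mem_unitaryGroup _ hU, ?_⟩, ?_⟩
  · have : U.det ≠ 0 := by simp [← norm_ne_zero_iff, hdet]
    simp [MonoidHom.mem_mker, hc', this]
  · simp [smul_smul]

/-- The homomorphism sending `w` to the diagonal matrix with entries `w j ^ d / ∏ i, w i`. -/
noncomputable def specialTorus (d : ℕ) :
    (Fin d → Circle) →* specialUnitaryGroup (Fin d) ℂ where
  toFun w := ⟨diagonal fun j => ((w j ^ d * (∏ i, w i)⁻¹ : Circle) : ℂ), by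
    rw [mem_specialUnitaryGroup_iff, mem_unitaryGroup_iff, star_eq_conjTranspose,
      diagonal_conjTranspose, diagonal_mul_diagonal, det_diagonal]
    refine ⟨?_, ?_⟩
    · rw [← diagonal_one]
      congr 1
      ext j
      exact (Complex.mul_conj _).trans (by rw [Circle.normSq_coe]; simp)
    · change ∏ j, Circle.coeHom (w j ^ d * (∏ i, w i)⁻¹) = 1
      rw [← map_prod, Finset.prod_mul_distrib, Finset.prod_pow]
      simp⟩
  map_one' := Subtype.ext (by simp)
  map_mul' w w' := Subtype.ext (by
    simp only [Submonoid.coe_mul, diagonal_mul_diagonal, ← Circle.coe_mul, Pi.mul_apply,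
      Finset.prod_mul_distrib, mul_inv, mul_pow]
    congr 1; ext j; congr 1; exact mul_mul_mul_comm _ _ _ _)

lemma specialTorus_coe (w : Fin d → Circle) :
    (specialTorus d w).1 = diagonal fun j => ((w j ^ d * (∏ i, w i)⁻¹ : Circle) : ℂ) := rfl

lemma specialTorus_const (z : Circle) : specialTorus d (fun _ => z) = 1 :=
  Subtype.ext (by simp [specialTorus_coe])

/-- Conjugating by a suitable special unitary matrix permutes the coordinates of the torus. -/
lemma exists_specialUnitary_conj_specialTorus (hd : d ≠ 0) (σ : Equiv.Perm (Fin d)) :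
    ∃ s : specialUnitaryGroup (Fin d) ℂ, ∀ w,
      s * specialTorus d w = specialTorus d (w ∘ σ) * s := by
  have hP : σ.permMatrix ℂ ∈ unitaryGroup (Fin d) ℂ := by
    rw [mem_unitaryGroup_iff, star_eq_conjTranspose, conjTranspose_permMatrix, ← permMatrix_mul]
    simp
  -- An odd permutation has determinant `-1`; the correcting scalar cancels under conjugation.
  obtain ⟨c, s, hs⟩ := exists_eq_smul_specialUnitary hd hP
  have hs' : s.1 = ((c⁻¹ : Circle) : ℂ) • σ.permMatrix ℂ := by rw [hs]; simp [smul_smul]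
  refine ⟨s, fun w => Subtype.ext ?_⟩
  simp only [Submonoid.coe_mul, hs', specialTorus_coe, smul_mul_assoc, mul_smul_comm]
  congr 1
  ext i j
  rw [mul_diagonal, diagonal_mul, Function.comp_apply]
  have : ∏ i, (w ∘ σ) i = ∏ i, w i := Equiv.prod_comp σ w
  rw [this]
  by_cases h : σ i = j
  · subst h; simp [PEquiv.toMatrix_apply]
  · simp [PEquiv.toMatrix_apply, h]

end Matrix

/-! ### Weights in small dimension -/

namespace Representation.IsUnitary

variable {d : ℕ} {V : Type*} [NormedAddCommGroup V] [InnerProductSpace ℂ V]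
  [FiniteDimensional ℂ V] {ρ : Representation ℂ (specialUnitaryGroup (Fin d) ℂ) V}

/-- If `finrank ℂ V < d`, then every weight of a unitary representation of `SU(d)` on `V` takes the
same value on all coordinates of the torus. -/
lemma weight_eq_of_finrank_lt (hρ : ρ.IsUnitary) (hd : finrank ℂ V < d)
    (χ : Fin d × Circle → ℂ)
    (hχ : ⨅ p : Fin d × Circle,
      End.eigenspace (ρ (specialTorus d (Pi.mulSingle p.1 p.2))) (χ p) ≠ ⊥)
    (i j : Fin d) (z : Circle) : χ (i, z) = χ (j, z) := by
  have hind := End.iSupIndep_iInf_eigenspace_of_inner_map_map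
    (fun p : Fin d × Circle => ρ (specialTorus d (Pi.mulSingle p.1 p.2))) (fun p => hρ _)
    (fun p q => by
      change ρ _ * ρ _ = ρ _ * ρ _
      rw [← map_mul, ← map_mul, ← map_mul, ← map_mul, mul_comm])
  by_contra hne
  obtain ⟨F, hF⟩ := exists_perm_family_comp_injective (fun k z => χ (k, z))
    (a := i) (b := j) (fun h => hne (congrFun h z))
  have hperm : ∀ σ : Equiv.Perm (Fin d), ⨅ p : Fin d × Circle,
      End.eigenspace (ρ (specialTorus d (Pi.mulSingle p.1 p.2))) (χ (σ p.1, p.2)) ≠ ⊥ := by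
    intro σ
    obtain ⟨v, hv, hv0⟩ := Submodule.exists_mem_ne_zero_of_ne_bot hχ
    simp only [Submodule.mem_iInf, End.mem_eigenspace_iff] at hv
    obtain ⟨s, hs⟩ := exists_specialUnitary_conj_specialTorus (by omega) σ
    refine Submodule.ne_bot_iff _ |>.2 ⟨ρ s v, ?_, fun h => hv0 ?_⟩
    · simp only [Submodule.mem_iInf, End.mem_eigenspace_iff]
      rintro ⟨k, z⟩
      have hk : (Pi.mulSingle k z : Fin d → Circle) = Pi.mulSingle (σ k) z ∘ σ := by
        ext m
        simp [Pi.mulSingle_apply]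
      have h1 := hv (σ k, z)
      dsimp only at h1 ⊢
      rw [hk, ← End.mul_apply, ← map_mul, ← hs, map_mul, End.mul_apply, h1, map_smul]
    · simpa using congrArg (ρ s⁻¹) h
  let _ := hind.fintypeNeBotOfFiniteDimensional
  have hcard := hind.subtype_ne_bot_le_finrank
  have := Fintype.card_le_of_injective
    (fun k : Fin d => (⟨fun p => χ (F k p.1, p.2), hperm (F k)⟩ :
      {ψ : Fin d × Circle → ℂ // ⨅ p : Fin d × Circle,
        End.eigenspace (ρ (specialTorus d (Pi.mulSingle p.1 p.2))) (ψ p) ≠ ⊥}))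
    (fun k l hkl => hF (by
      funext m z
      exact congrFun (Subtype.ext_iff.1 hkl) (m, z)))
  rw [Fintype.card_fin] at this
  omega

/-- The torus parametrisation kills constant tuples, so a weight with equal coordinates satisfies
`χ(u)^d = 1`; as every `z` is some `u^d`, `χ(z) = 1`. -/
lemma map_specialTorus_of_finrank_lt (hρ : ρ.IsUnitary) (hd : finrank ℂ V < d)
    (w : Fin d → Circle) : ρ (specialTorus d w) = 1 := by
  have htop := End.iSup_iInf_eigenspace_eq_top_of_inner_map_map
    (fun p : Fin d × Circle => ρ (specialTorus d (Pi.mulSingle p.1 p.2))) (fun p => hρ _)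
    (fun p q => by
      change ρ _ * ρ _ = ρ _ * ρ _
      rw [← map_mul, ← map_mul, ← map_mul, ← map_mul, mul_comm])
  have hsingle : ∀ i z, ρ (specialTorus d (Pi.mulSingle i z)) = 1 := by
    intro i z
    suffices (⊤ : Submodule ℂ V) ≤
        End.eigenspace (ρ (specialTorus d (Pi.mulSingle i z))) 1 by
      ext v
      simpa using End.mem_eigenspace_iff.1 (this (Submodule.mem_top (x := v)))
    rw [← htop, iSup_le_iff]
    intro χ
    by_cases hχ : ⨅ p : Fin d × Circle,
      End.eigenspace (ρ (specialTorus d (Pi.mulSingle p.1 p.2))) (χ p) = ⊥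
    · exact hχ.le.trans bot_le
    have hconst := hρ.weight_eq_of_finrank_lt hd χ hχ
    obtain ⟨v, hv, hv0⟩ := Submodule.exists_mem_ne_zero_of_ne_bot hχ
    simp only [Submodule.mem_iInf, End.mem_eigenspace_iff] at hv
    obtain ⟨u, rfl⟩ := Circle.exists_pow_eq z (d := d) (by omega)
    have hpow : χ (i, u) ^ d = 1 := by
      have hprod : ∀ s : Finset (Fin d),
          ρ (specialTorus d (∏ j ∈ s, Pi.mulSingle j u)) v = χ (i, u) ^ s.card • v := by
        intro s
        induction s using Finset.induction_on with
        | empty => simp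
        | insert a s ha ih =>
          rw [Finset.prod_insert ha, map_mul, map_mul, End.mul_apply, ih, map_smul, hv (a, u),
            hconst a i, Finset.card_insert_of_notMem ha, pow_succ, smul_smul]
      have h1 := hprod Finset.univ
      rw [Finset.univ_prod_mulSingle (fun _ => u), specialTorus_const, Finset.card_univ,
        Fintype.card_fin, map_one, End.one_apply] at h1
      have h2 : (χ (i, u) ^ d - 1) • v = 0 := by rw [sub_smul, ← h1, one_smul, sub_self]
      exact sub_eq_zero.1 ((smul_eq_zero.1 h2).resolve_right hv0)
    have hone : χ (i, u ^ d) = 1 := by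
      have hpow' : ∀ m : ℕ, ρ (specialTorus d (Pi.mulSingle i (u ^ m))) v = χ (i, u) ^ m • v := by
        intro m
        induction m with
        | zero => simp
        | succ m ih =>
          rw [pow_succ', Pi.mulSingle_mul, map_mul, map_mul, End.mul_apply, ih, map_smul,
            hv (i, u), smul_smul, pow_succ]
      have h1 := hpow' d
      rw [hv (i, u ^ d), hpow] at h1
      have h2 : (χ (i, u ^ d) - 1) • v = 0 := by rw [sub_smul, h1, sub_self]
      exact sub_eq_zero.1 ((smul_eq_zero.1 h2).resolve_right hv0)
    exact (iInf_le _ (i, u ^ d)).trans (by rw [hone])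
  rw [← Finset.univ_prod_mulSingle w]
  exact Finset.prod_induction _ (fun u => ρ (specialTorus d u) = 1)
    (fun u u' hu hu' => by rw [map_mul, map_mul, hu, hu', one_mul]) (by simp)
    fun i _ => hsingle i (w i)

/-- If `finrank ℂ V < d`, then every unitary matrix is a scalar multiple of an element of the
kernel of a given unitary representation of `SU(d)` on `V`. -/
lemma exists_eq_smul_mem_ker (hρ : ρ.IsUnitary) (hd : finrank ℂ V < d)
    {U : Matrix (Fin d) (Fin d) ℂ} (hU : U ∈ unitaryGroup (Fin d) ℂ) :
    ∃ (c : Circle) (s : specialUnitaryGroup (Fin d) ℂ), U = (c : ℂ) • s.1 ∧ ρ s = 1 := by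
  obtain ⟨W, hW, z, rfl⟩ := exists_unitary_diagonalization hU
  obtain ⟨c, s, rfl⟩ := exists_eq_smul_specialUnitary (by omega) hW
  -- With `z i = w i ^ d`, the diagonal matrix is `∏ w i` times a torus element, which lies in the
  -- kernel.
  choose w hw using fun i => Circle.exists_pow_eq (z i) (d := d) (by omega)
  refine ⟨∏ i, w i, s * specialTorus d w * s⁻¹, ?_, ?_⟩
  · have h1 : Matrix.diagonal (fun i => (z i : ℂ)) =
        ((∏ i, w i : Circle) : ℂ) • (specialTorus d w).1 := by
      rw [specialTorus_coe, ← Matrix.diagonal_smul]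
      congr 1
      funext i
      rw [Pi.smul_apply, smul_eq_mul, ← Circle.coe_mul, hw i, mul_comm (z i),
        mul_inv_cancel_left]
    have h2 : (s⁻¹).1 = star s.1 := rfl
    have h3 : (c : ℂ) * star (c : ℂ) = 1 := by
      rw [← starRingEnd_apply, ← Circle.coe_inv_eq_conj]; simp
    rw [h1, Submonoid.coe_mul, Submonoid.coe_mul, h2, star_smul]
    simp only [smul_mul_assoc, mul_smul_comm, smul_smul]
    congr 1
    linear_combination ((∏ i, w i : Circle) : ℂ) * h3
  · rw [map_mul, map_mul, hρ.map_specialTorus_of_finrank_lt hd, mul_one, ← map_mul,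
      mul_inv_cancel, map_one]

end Representation.IsUnitary

/-- A unitary representation of `U(d)` or `SU(d)` (given by `G` with an injective homomorphism `j`
to `U(d)` through which the inclusion `i` of `SU(d)` factors) on a space of dimension less than `d`
has commuting operators. -/
lemma Representation.IsUnitary.commute_of_finrank_lt {d : ℕ} {G V : Type*} [Group G]
    [NormedAddCommGroup V] [InnerProductSpace ℂ V] [FiniteDimensional ℂ V]
    {ρ : Representation ℂ G V} (hρ : ρ.IsUnitary) (hd : finrank ℂ V < d)
    (i : specialUnitaryGroup (Fin d) ℂ →* G) (j : G →* unitaryGroup (Fin d) ℂ)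
    (hj : Function.Injective j) (hij : ∀ s, (j (i s)).1 = s.1) (g h : G) :
    Commute (ρ g) (ρ h) := by
  have hρ' : Representation.IsUnitary (ρ.comp i) := fun s => hρ (i s)
  obtain ⟨a, s, hgs, hs⟩ := hρ'.exists_eq_smul_mem_ker hd (j g).2
  obtain ⟨b, t, hht, ht⟩ := hρ'.exists_eq_smul_mem_ker hd (j h).2
  have hs' : ρ (i s) = 1 := hs
  have ht' : ρ (i t) = 1 := ht
  -- Writing `g = a s` and `h = b t`, both sides are `ab · s t t s`.
  have key : g * h * i (t * s) = i (s * t) * (h * g) := by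
    apply hj
    apply Subtype.ext
    simp only [map_mul, Submonoid.coe_mul, hij, hgs, hht, smul_mul_assoc, mul_smul_comm, smul_smul,
      mul_assoc, mul_comm (a : ℂ)]
  have := congrArg ρ key
  change ρ g * ρ h = ρ h * ρ g
  simpa [map_mul, hs', ht'] using this

theorem mainTheorem3 (d n : ℕ) (hn : 2 ≤ n) (hnd : n + 1 ≤ d)
    {V : Type*} [NormedAddCommGroup V] [InnerProductSpace ℂ V]
    (hV : Module.finrank ℂ V = n) :
    (¬ ∃ ρ : Representation ℂ (Matrix.unitaryGroup (Fin d) ℂ) V,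
        ρ.IsUnitary ∧ ρ.IsIrreducible) ∧
    (¬ ∃ ρ : Representation ℂ (Matrix.specialUnitaryGroup (Fin d) ℂ) V,
        ρ.IsUnitary ∧ ρ.IsIrreducible) := by
  have hpos : 0 < finrank ℂ V := by omega
  have : FiniteDimensional ℂ V := Module.finite_of_finrank_pos hpos
  let ι : specialUnitaryGroup (Fin d) ℂ →* unitaryGroup (Fin d) ℂ :=
    Submonoid.inclusion specialUnitaryGroup_le_unitaryGroup
  constructor
  · rintro ⟨ρ, hρ, hirr⟩
    have := hρ.finrank_eq_one_of_commute hirr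
      (hρ.commute_of_finrank_lt (by omega) ι (MonoidHom.id _) Function.injective_id fun _ => rfl)
    omega
  · rintro ⟨ρ, hρ, hirr⟩
    have := hρ.finrank_eq_one_of_commute hirr
      (hρ.commute_of_finrank_lt (by omega) (MonoidHom.id _) ι
        (Submonoid.inclusion_injective _) fun _ => rfl)
    omega
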